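/- Let $n$ denote a nonnegative integer. A category $\mathcal{C}$ is additive if it is preadditive and has all finite direct sums. For such a $\mathcal{C}$, let $\operatorname{mod}\mathcal{C}$ be the category of finitely presented right $\mathcal{C}$-modules, that is, of functors $F:\mathcal{C}^{\mathrm{op}}\to\mathrm{Ab}$ for which there is an exact sequence $\mathcal{C}(-,X)\to\mathcal{C}(-,Y)\to F\to 0$. An additive idempotent complete category $\mathcal{C}$ is called $0$-abelian if $\operatorname{mod}\mathcal{C}$ and $\operatorname{mod}\mathcal{C}^{\mathrm{op}}$ are abelian categories (i.e. $\mathcal{C}$ is right and left coherent) of global dimension at most $1$. For $n\geq 1$, $n$-abelian is meant in the sense of Jasso: $\mathcal{C}$ is additive and idempotent complete, every morphism has an $n$-kernel and an $n$-cokernel, every monomorphism together with any $n$-cokernel of it forms an $n$-exact sequence, and every epimorphism together with any $n$-kernel of it forms an $n$-exact sequence. Here, for a sequence $X_0\to X_1\to\cdots\to X_n\to X_{n+1}$, the first $n$ morphisms form an $n$-kernel of the last one if $0\to\mathcal{C}(W,X_0)\to\cdots\to\mathcal{C}(W,X_n)\to\mathcal{C}(W,X_{n+1})$ is exact for all $W\in\mathcal{C}$,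 dually the last $n$ morphisms form an $n$-cokernel of the first one if $0\to\mathcal{C}(X_{n+1},W)\to\cdots\to\mathcal{C}(X_1,W)\to\mathcal{C}(X_0,W)$ is exact for all $W\in\mathcal{C}$, and the sequence is $n$-exact if both hold. A $0$-cokernel of a morphism $f$ is an epimorphism $s$ such that $f=rs$ for some split monomorphism $r$. A weak kernel of $f:X\to Y$ is a morphism $k:K\to X$ with $fk=0$ through which every $g$ with $fg=0$ factors (not necessarily uniquely). An object is injective if morphisms into it extend along all monomorphisms, and $\mathcal{C}$ has enough injectives if every object admits a monomorphism into an injective object. The injectively stable category $\overline{\mathcal{C}}$ is the quotient of $\mathcal{C}$ by the ideal of the morphisms that factor through an injective object. Let $\mathcal{C}$ be a $0$-abelian category with enough injectives. Then $\overline{\mathcal{C}}$ is additive, idempotent complete, and every morphism in $\overline{\mathcal{C}}$ has a $0$-cokernel. Moreover, the following are equivalent: (a) $\overline{\mathcal{C}}$ is $0$-abelian; (b) $\overline{\mathcal{C}}$ is $n$-abelian for some nonnegative integer $n$; (c) $\overline{\mathcal{C}}$ has weak kernels, that is, every morphism in $\overline{\mathcal{C}}$ has a weak kernel. Finally, suppose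 that the full subcategory of injective objects is contravariantly finite in $\mathcal{C}$, that is, for every $X\in\mathcal{C}$ there is a morphism $B\to X$ with $B$ injective through which every morphism $D\to X$ with $D$ injective factors. Then $\overline{\mathcal{C}}$ is $0$-abelian. -/

import Mathlib

open CategoryTheory CategoryTheory.Limits

universe v u

namespace NAbelian

section FinitelyPresented

variable (C : Type u) [Category.{v} C] [Preadditive C]

/-- A functor `F : Cᵒᵖ ⥤ Ab` is a finitely presented right `C`-module when there is an exact
sequence `C(-, X) ⟶ C(-, Y) ⟶ F ⟶ 0`. Such a functor is automatically additive, since it is a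
cokernel of a morphism between additive functors. -/
def finitelyPresented : ObjectProperty (Cᵒᵖ ⥤ AddCommGrpCat.{v}) := fun F =>
  ∃ (X Y : C) (f : X ⟶ Y) (p : preadditiveYoneda.obj Y ⟶ F)
    (w : preadditiveYoneda.map f ≫ p = 0),
    (ShortComplex.mk (preadditiveYoneda.map f) p w).Exact ∧ Epi p

/-- The category `mod C` of finitely presented right `C`-modules. For `Cᵒᵖ` in place of `C` this
is the category `mod Cᵒᵖ` of finitely presented left `C`-modules. -/
abbrev FPMod := (finitelyPresented C).FullSubcategory

end FinitelyPresented

/-- The abelian category `A` has global dimension at most `m`. -/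
def GlobalDimensionLE (A : Type u) [Category.{v} A] [Abelian A] (m : ℕ) : Prop :=
  ∀ X : A, HasProjectiveDimensionLE X m

section ZeroAbelian

variable (C : Type u) [Category.{v} C] [Preadditive C]

/-- `C` is right coherent, that is, `mod C` is an abelian category, and the global dimension of
`mod C` is at most `1`. -/
def AxiomZeroF1 : Prop := ∃ _ : Abelian (FPMod C), GlobalDimensionLE (FPMod C) 1

/-- A `0`-abelian category: an additive and idempotent complete category which is right and left
coherent and such that `mod C` and `mod Cᵒᵖ` have global dimension at most `1`. -/
structure IsZeroAbelian : Prop where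
  additive : HasFiniteBiproducts C
  idempotentComplete : IsIdempotentComplete C
  /-- `C` is right coherent and `mod C` has global dimension at most `1` -/
  f1 : AxiomZeroF1 C
  /-- `C` is left coherent and `mod Cᵒᵖ` has global dimension at most `1` -/
  f1_op : AxiomZeroF1 Cᵒᵖ

end ZeroAbelian

section Jasso

variable {C : Type u} [Category.{v} C] [Preadditive C]

/-- For a sequence `X₀ ⟶ X₁ ⟶ ⋯ ⟶ Xₙ ⟶ Xₙ₊₁`, the first `n` morphisms form an `n`-kernel of the
last one: for every object `W`, the sequence
`0 ⟶ C(W, X₀) ⟶ C(W, X₁) ⟶ ⋯ ⟶ C(W, Xₙ) ⟶ C(W, Xₙ₊₁)` is exact. -/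
structure IsNKernel {n : ℕ} (S : ComposableArrows C (n + 1)) : Prop where
  complex : S.IsComplex
  mono : Mono (S.map' 0 1)
  exact : ∀ (i : ℕ) (hi : i + 2 ≤ n + 1) ⦃W : C⦄ (g : W ⟶ S.obj' (i + 1)),
    g ≫ S.map' (i + 1) (i + 2) = 0 → ∃ h : W ⟶ S.obj' i, h ≫ S.map' i (i + 1) = g

/-- For a sequence `X₀ ⟶ X₁ ⟶ ⋯ ⟶ Xₙ ⟶ Xₙ₊₁`, the last `n` morphisms form an `n`-cokernel of the
first one: for every object `W`, the sequence
`0 ⟶ C(Xₙ₊₁, W) ⟶ C(Xₙ, W) ⟶ ⋯ ⟶ C(X₁, W) ⟶ C(X₀, W)` is exact. -/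
structure IsNCokernel {n : ℕ} (S : ComposableArrows C (n + 1)) : Prop where
  complex : S.IsComplex
  epi : Epi (S.map' n (n + 1))
  exact : ∀ (i : ℕ) (hi : i + 2 ≤ n + 1) ⦃W : C⦄ (g : S.obj' (i + 1) ⟶ W),
    S.map' i (i + 1) ≫ g = 0 → ∃ h : S.obj' (i + 2) ⟶ W, S.map' (i + 1) (i + 2) ≫ h = g

/-- An `n`-exact sequence `X₀ ⟶ X₁ ⟶ ⋯ ⟶ Xₙ ⟶ Xₙ₊₁`. -/
def IsNExact {n : ℕ} (S : ComposableArrows C (n + 1)) : Prop := IsNKernel S ∧ IsNCokernel S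

variable (C)

/-- Jasso's axioms of an `n`-abelian category (meant for a positive integer `n`). -/
structure IsJassoNAbelian (n : ℕ) : Prop where
  additive : HasFiniteBiproducts C
  idempotentComplete : IsIdempotentComplete C
  /-- every morphism has an `n`-kernel -/
  exists_nKernel : ∀ ⦃X Y : C⦄ (f : X ⟶ Y), ∃ S : ComposableArrows C (n + 1),
    Arrow.mk (S.map' n (n + 1)) = Arrow.mk f ∧ IsNKernel S
  /-- every morphism has an `n`-cokernel -/
  exists_nCokernel : ∀ ⦃X Y : C⦄ (f : X ⟶ Y), ∃ S : ComposableArrows C (n + 1),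
    Arrow.mk (S.map' 0 1) = Arrow.mk f ∧ IsNCokernel S
  /-- a monomorphism followed by any `n`-cokernel of it is an `n`-exact sequence -/
  nExact_of_mono : ∀ S : ComposableArrows C (n + 1),
    Mono (S.map' 0 1) → IsNCokernel S → IsNExact S
  /-- an epimorphism preceded by any `n`-kernel of it is an `n`-exact sequence -/
  nExact_of_epi : ∀ S : ComposableArrows C (n + 1),
    Epi (S.map' n (n + 1)) → IsNKernel S → IsNExact S

/-- `n`-abelian categories, for a nonnegative integer `n`. -/
def IsNAbelian : ℕ → Prop
  | 0 => IsZeroAbelian C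
  | n + 1 => IsJassoNAbelian C (n + 1)

end Jasso

section ZeroCokernels

variable {C : Type u} [Category.{v} C]

/-- `s` is a `0`-cokernel of `f`: it is an epimorphism such that `f` is the composite of `s`
followed by a split monomorphism. -/
def IsZeroCokernel {X Y V : C} (f : X ⟶ Y) (s : X ⟶ V) : Prop :=
  Epi s ∧ ∃ r : V ⟶ Y, IsSplitMono r ∧ s ≫ r = f

variable (C)

/-- Every morphism has a `0`-cokernel. -/
def HasZeroCokernels : Prop :=
  ∀ ⦃X Y : C⦄ (f : X ⟶ Y), ∃ (V : C) (s : X ⟶ V), IsZeroCokernel f s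

end ZeroCokernels

/-- The (full) subcategory `B` of `C` is contravariantly finite in `C`: every object `X` admits a
morphism `B₀ ⟶ X` with `B₀` in `B` through which every morphism `D ⟶ X` with `D` in `B` factors. -/
def IsContravariantlyFinite {C : Type u} [Category.{v} C] (B : ObjectProperty C) : Prop :=
  ∀ X : C, ∃ (B₀ : C) (p : B₀ ⟶ X), B B₀ ∧
    ∀ ⦃D : C⦄ (g : D ⟶ X), B D → ∃ h : D ⟶ B₀, h ≫ p = g

section Stable

variable {C : Type u} [Category.{v} C]

/-- The morphism `f` factors through an injective object. -/
def FactorsThroughInjective {X Y : C} (f : X ⟶ Y) : Prop :=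
  ∃ (I : C) (a : X ⟶ I) (b : I ⟶ Y), Injective I ∧ a ≫ b = f

lemma FactorsThroughInjective.comp_left {X Y Z : C} (f : X ⟶ Y) {g : Y ⟶ Z}
    (hg : FactorsThroughInjective g) : FactorsThroughInjective (f ≫ g) := by
  obtain ⟨I, a, b, hI, rfl⟩ := hg
  exact ⟨I, f ≫ a, b, hI, by simp⟩

lemma FactorsThroughInjective.comp_right {X Y Z : C} {f : X ⟶ Y} (g : Y ⟶ Z)
    (hf : FactorsThroughInjective f) : FactorsThroughInjective (f ≫ g) := by
  obtain ⟨I, a, b, hI, rfl⟩ := hf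
  exact ⟨I, a, b ≫ g, hI, by simp⟩

variable [Preadditive C]

lemma FactorsThroughInjective.neg {X Y : C} {f : X ⟶ Y} (hf : FactorsThroughInjective f) :
    FactorsThroughInjective (-f) := by
  obtain ⟨I, a, b, hI, rfl⟩ := hf
  exact ⟨I, -a, b, hI, by simp⟩

variable [HasFiniteBiproducts C]

lemma FactorsThroughInjective.zero (X Y : C) : FactorsThroughInjective (0 : X ⟶ Y) :=
  ⟨⊤_ C, 0, 0, ⟨fun _ _ _ => ⟨terminal.from _, Subsingleton.elim _ _⟩⟩, by simp⟩

lemma FactorsThroughInjective.add {X Y : C} {f g : X ⟶ Y} (hf : FactorsThroughInjective f)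
    (hg : FactorsThroughInjective g) : FactorsThroughInjective (f + g) := by
  obtain ⟨I, a, b, hI, rfl⟩ := hf
  obtain ⟨J, c, d, hJ, rfl⟩ := hg
  have : HasBinaryBiproducts C := hasBinaryBiproducts_of_finite_biproducts C
  exact ⟨I ⊞ J, biprod.lift a c, biprod.desc b d, inferInstance, by simp⟩

variable (C)

/-- Two parallel morphisms are identified when their difference belongs to the ideal of the
morphisms that factor through an injective object. -/
def injRel : HomRel C := fun _ _ f g => FactorsThroughInjective (f - g)

instance : Congruence (injRel C) where
  equivalence :=
    { refl := fun f => by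
        change FactorsThroughInjective (f - f)
        simpa using FactorsThroughInjective.zero _ _
      symm := fun {f g} h => by
        change FactorsThroughInjective (g - f)
        simpa using FactorsThroughInjective.neg h
      trans := fun {f g k} h h' => by
        change FactorsThroughInjective (f - k)
        simpa using FactorsThroughInjective.add h h' }
  comp_left f _ _ h := by
    change FactorsThroughInjective _
    rw [← Preadditive.comp_sub]
    exact FactorsThroughInjective.comp_left f h
  comp_right g h := by
    change FactorsThroughInjective _
    rw [← Preadditive.sub_comp]
    exact FactorsThroughInjective.comp_right g h

/-- The injectively stable category of `C`: the quotient of `C` by the ideal of the morphisms that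
factor through an injective object. -/
abbrev InjStable := CategoryTheory.Quotient (injRel C)

instance : Preadditive (InjStable C) :=
  Quotient.preadditive (injRel C) fun X Y f₁ f₂ g₁ g₂ h h' => by
    change FactorsThroughInjective _
    rw [add_sub_add_comm]
    exact FactorsThroughInjective.add h h'

end Stable

end NAbelian

open NAbelian

/-!
A `0`-abelian category is an additive category in which every morphism is a split epimorphism
followed by a monomorphism (`HasZeroKernels`) and, dually, an epimorphism followed by a split
monomorphism (`HasZeroCokernels`); this is `isZeroAbelian_iff`. On the module side: if `mod C` is
abelian of global dimension at most `1`, then the image of `C(-, X) ⟶ C(-, Y)` is projective, hence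
a direct summand of `C(-, X)`, and splitting the corresponding idempotent of `X` factors `X ⟶ Y`.
Conversely such factorizations give weak kernels, so that finitely presented modules are closed
under kernels, cokernels and finite products in the category of all functors `Cᵒᵖ ⥤ Ab`, and they
shorten each presentation to a projective resolution of length `1`.

In the stable category, every morphism is represented by a monomorphism of `C`, after adding an
embedding into an injective object. The `0`-cokernel of this monomorphism in `C` is also a
monomorphism, and such an epimorphism remains an epimorphism stably, because morphisms into
injective objects extend along it. So the stable category always has `0`-cokernels, and with them
split idempotents. Given `0`-cokernels, weak kernels produce `0`-kernels: the `0`-cokernel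
factorization of a weak kernel `K ⟶ X` of `f` yields a direct summand of `X` which is a weak kernel,
and `f` is a monomorphism on its complement. Thus weak kernels in the stable category suffice for it
to be `0`-abelian; the other implications hold because `n`-kernels and `0`-kernels contain weak
kernels. When the injective objects are contravariantly finite, weak kernels in the stable category
are weak pullbacks in `C` along approximations by injective objects.
-/

namespace NAbelian

/-! ### Weak kernels and `0`-kernels -/

/-- Every morphism is a split epimorphism followed by a monomorphism; dual to
`HasZeroCokernels`. -/
def HasZeroKernels (C : Type u) [Category.{v} C] : Prop :=
  ∀ ⦃X Y : C⦄ (f : X ⟶ Y), ∃ (V : C) (s : X ⟶ V) (r : V ⟶ Y), IsSplitEpi s ∧ Mono r ∧ s ≫ r = f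

lemma hasZeroKernels_op_iff {C : Type u} [Category.{v} C] :
    HasZeroKernels Cᵒᵖ ↔ HasZeroCokernels C := by
  constructor
  · intro h X Y f
    obtain ⟨V, s, r, ⟨⟨t⟩⟩, hr, hsr⟩ := h f.op
    refine ⟨V.unop, r.unop, inferInstance, s.unop, ⟨⟨t.section_.unop, ?_⟩⟩, ?_⟩
    · rw [← unop_comp, t.id, unop_id]
    · rw [← unop_comp, hsr, Quiver.Hom.unop_op]
  · intro h X Y f
    obtain ⟨V, s, hs, r, ⟨⟨t⟩⟩, hsr⟩ := h f.unop
    refine ⟨.op V, r.op, s.op, ⟨⟨t.retraction.op, ?_⟩⟩, inferInstance, ?_⟩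
    · rw [← op_comp, t.id, op_id]
    · rw [← op_comp, hsr, Quiver.Hom.op_unop]

section WeakKernels

variable {C : Type u} [Category.{v} C] [Preadditive C]

lemma hasWeakKernels_iff :
    HasWeakKernels C ↔ ∀ ⦃X Y : C⦄ (f : X ⟶ Y), ∃ (K : C) (k : K ⟶ X), k ≫ f = 0 ∧
      ∀ ⦃W : C⦄ (g : W ⟶ X), g ≫ f = 0 → ∃ h : W ⟶ K, h ≫ k = g := by
  constructor
  · intro _ X Y f
    exact ⟨_, weakKernel.ι f, weakKernel.condition f,
      fun W g hg => ⟨weakKernel.lift f g hg, weakKernel.lift_ι f g hg⟩⟩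
  · intro h
    refine ⟨fun {X Y} f => ?_⟩
    obtain ⟨K, k, hk, hk'⟩ := h f
    exact .mk ⟨_, Fork.IsWeakLimit.mk' (KernelFork.ofι k hk) fun s =>
      ⟨(hk' s.ι (KernelFork.condition s)).choose, (hk' s.ι (KernelFork.condition s)).choose_spec⟩⟩

lemma HasZeroKernels.hasWeakKernels (h : HasZeroKernels C) : HasWeakKernels C := by
  refine hasWeakKernels_iff.2 fun X Y f => ?_
  obtain ⟨V, s, r, ⟨⟨t⟩⟩, hr, rfl⟩ := h f
  -- for a section `t` of `s`, the projection `𝟙 - s ≫ t` onto the kernel of `s` is a weak kernel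
  refine ⟨X, 𝟙 X - s ≫ t.section_, by simp [Preadditive.sub_comp], fun W g hg => ⟨g, ?_⟩⟩
  have hgs : g ≫ s = 0 := by rwa [← cancel_mono r, Category.assoc, zero_comp]
  simp [Preadditive.comp_sub, reassoc_of% hgs]

/-- Weak pullbacks exist in an additive category with weak kernels. -/
lemma exists_weakPullback [HasBinaryBiproducts C] [HasWeakKernels C] {A B D : C} (a : A ⟶ D)
    (b : B ⟶ D) : ∃ (P : C) (p : P ⟶ A) (q : P ⟶ B), p ≫ a = q ≫ b ∧
      ∀ ⦃W : C⦄ (s : W ⟶ A) (t : W ⟶ B), s ≫ a = t ≫ b →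
        ∃ h : W ⟶ P, h ≫ p = s ∧ h ≫ q = t := by
  obtain ⟨P, k, hk, hk'⟩ := hasWeakKernels_iff.1 ‹_› (biprod.desc a (-b))
  refine ⟨P, k ≫ biprod.fst, k ≫ biprod.snd, ?_, fun W s t hst => ?_⟩
  · rw [biprod.desc_eq, Preadditive.comp_add, Preadditive.comp_neg, Preadditive.comp_neg,
      ← sub_eq_add_neg, sub_eq_zero] at hk
    simpa using hk
  · obtain ⟨h, hh⟩ := hk' (biprod.lift s t) (by simp [hst])
    exact ⟨h, by simp [reassoc_of% hh], by simp [reassoc_of% hh]⟩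

end WeakKernels

section ZeroCokernels

variable {C : Type u} [Category.{v} C]

/-- If an idempotent `e` is an epimorphism `s` followed by a split monomorphism `r`, then `s` and
`r` split `e`. -/
lemma HasZeroCokernels.isIdempotentComplete (h : HasZeroCokernels C) :
    IsIdempotentComplete C := by
  refine ⟨fun X e he => ?_⟩
  obtain ⟨V, s, hs, r, hr, rfl⟩ := h e
  refine ⟨V, r, s, ?_, rfl⟩
  rw [← cancel_epi s, ← cancel_mono r]
  simpa using he

variable [Preadditive C]

/-- A weak kernel of `f` may be replaced by the split monomorphism of its `0`-cokernel
factorization; the restriction of `f` to a complement is then a monomorphism. -/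
lemma HasZeroCokernels.hasZeroKernels (h : HasZeroCokernels C) [HasWeakKernels C] :
    HasZeroKernels C := by
  intro X Y f
  obtain ⟨K, k, hk, hk'⟩ := hasWeakKernels_iff.1 ‹_› f
  obtain ⟨V, s, hs, r, ⟨⟨q⟩⟩, rfl⟩ := h k
  have hrf : r ≫ f = 0 := by rwa [← cancel_epi s, comp_zero, ← Category.assoc]
  have hq := q.id
  obtain ⟨U, i, p, hip, hpi⟩ := h.isIdempotentComplete.idempotents_split X
    (𝟙 X - q.retraction ≫ r) (by simp [Preadditive.sub_comp, Preadditive.comp_sub,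
      reassoc_of% hq])
  have hrp : r ≫ p = 0 := by
    have : (r ≫ p) ≫ i = 0 := by
      rw [Category.assoc, hpi]; simp [Preadditive.comp_sub, reassoc_of% hq]
    have h2 := congr($this ≫ p)
    simpa [hip] using h2
  refine ⟨U, p, i ≫ f, ⟨⟨i, hip⟩⟩, ?_, ?_⟩
  · refine Preadditive.mono_of_cancel_zero _ fun {W} g hg => ?_
    obtain ⟨l, hl⟩ := hk' (g ≫ i) (by simpa using hg)
    have h2 := congr($hl ≫ p)
    simpa [hrp, hip] using h2.symm
  · rw [← Category.assoc, hpi]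
    simp [Preadditive.sub_comp, hrf]

end ZeroCokernels

/-- The `n`-kernel of a morphism ends with a weak kernel of it. -/
lemma IsJassoNAbelian.hasWeakKernels {C : Type u} [Category.{v} C] [Preadditive C] {n : ℕ}
    (h : IsJassoNAbelian C (n + 1)) : HasWeakKernels C := by
  rw [hasWeakKernels_iff]
  suffices H : ∀ a : Arrow C, ∃ (K : C) (k : K ⟶ a.left), k ≫ a.hom = 0 ∧
      ∀ ⦃W : C⦄ (g : W ⟶ a.left), g ≫ a.hom = 0 → ∃ h : W ⟶ K, h ≫ k = g from
    fun X Y f => H (Arrow.mk f)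
  intro a
  obtain ⟨S, hS, hK⟩ := h.exists_nKernel a.hom
  obtain rfl : _ = a := hS
  exact ⟨_, S.map' n (n + 1), hK.complex.zero n, hK.exact n le_rfl⟩

/-! ### The injectively stable category -/

section InjStable

variable (C : Type u) [Category.{v} C] [Preadditive C] [HasFiniteBiproducts C]

/-- The projection of `C` onto its injectively stable category. -/
abbrev toInjStable : C ⥤ InjStable C := Quotient.functor (injRel C)

instance : (toInjStable C).Additive where
  map_add := rfl

instance : HasFiniteBiproducts (InjStable C) where
  out _ := ⟨fun f =>
    (inferInstance : HasBiproduct fun i => (toInjStable C).obj (f i).as)⟩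

variable {C}

lemma toInjStable_map_eq_zero_iff {X Y : C} (f : X ⟶ Y) :
    (toInjStable C).map f = 0 ↔ FactorsThroughInjective f := by
  rw [← (toInjStable C).map_zero, Quotient.functor_map_eq_iff]
  change FactorsThroughInjective (f - 0) ↔ _
  rw [sub_zero]

/-- A morphism which is both a monomorphism and an epimorphism stays an epimorphism in the injectively
stable category: a morphism into an injective object extends along it. -/
lemma epi_toInjStable_map {X V : C} (s : X ⟶ V) [Mono s] [Epi s] :
    Epi ((toInjStable C).map s) := by
  refine Preadditive.epi_of_cancel_zero _ fun {Z} g hg => ?_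
  obtain ⟨g, rfl⟩ := (toInjStable C).map_surjective (Y := Z.as) g
  rw [← Functor.map_comp, toInjStable_map_eq_zero_iff] at hg
  obtain ⟨I, a, b, hI, hab⟩ := hg
  refine (toInjStable_map_eq_zero_iff g).2 ⟨I, Injective.factorThru a s, b, hI, ?_⟩
  rw [← cancel_epi s, Injective.comp_factorThru_assoc, hab]

/-- Adding an embedding of the source into an injective object makes a morphism a monomorphism
without changing it in the injectively stable category; the `0`-cokernel of this monomorphism is
then a `0`-cokernel of the stable morphism. -/
lemma HasZeroCokernels.injStable [EnoughInjectives C] (h : HasZeroCokernels C) :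
    HasZeroCokernels (InjStable C) := by
  rintro ⟨X⟩ ⟨Y⟩ f
  obtain ⟨f, rfl⟩ := (toInjStable C).map_surjective (X := X) (Y := Y) f
  have := hasBinaryBiproducts_of_finite_biproducts C
  obtain ⟨V, s, hs, r, ⟨⟨q⟩⟩, hsr⟩ := h (biprod.lift f (Injective.ι X))
  have : Mono (s ≫ r) := by
    have : Mono ((s ≫ r) ≫ biprod.snd) := by rw [hsr, biprod.lift_snd]; infer_instance
    exact mono_of_mono _ biprod.snd
  have : Mono s := mono_of_mono s r
  refine ⟨(toInjStable C).obj V, (toInjStable C).map s, epi_toInjStable_map s,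
    (toInjStable C).map (r ≫ biprod.fst),
    ⟨⟨(toInjStable C).map (biprod.inl ≫ q.retraction), ?_⟩⟩, ?_⟩
  · rw [← Functor.map_comp, ← (toInjStable C).map_id V, ← sub_eq_zero, ← Functor.map_sub,
      toInjStable_map_eq_zero_iff]
    -- the difference is, up to sign, the composite through the injective summand
    refine ⟨_, r ≫ biprod.snd, -(biprod.inr ≫ q.retraction), inferInstance, ?_⟩
    have h1 : r ≫ biprod.fst ≫ biprod.inl ≫ q.retraction +
        r ≫ biprod.snd ≫ biprod.inr ≫ q.retraction = 𝟙 V := by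
      rw [← q.id, ← Preadditive.comp_add, ← Category.assoc biprod.fst,
        ← Category.assoc biprod.snd, ← Preadditive.add_comp, biprod.total, Category.id_comp]
    rw [← h1]
    simp
  · rw [← Functor.map_comp, reassoc_of% hsr, biprod.lift_fst]

/-- A weak kernel of the stable class of `f : X ⟶ Y` is a weak pullback of `f` along an
approximation of `Y` by an injective object. -/
lemma hasWeakKernels_injStable [HasWeakKernels C]
    (h : IsContravariantlyFinite (isInjective C)) : HasWeakKernels (InjStable C) := by
  refine hasWeakKernels_iff.2 ?_
  rintro ⟨X⟩ ⟨Y⟩ f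
  obtain ⟨f, rfl⟩ := (toInjStable C).map_surjective (X := X) (Y := Y) f
  have := hasBinaryBiproducts_of_finite_biproducts C
  obtain ⟨B, p, hB, hp⟩ := h Y
  obtain ⟨P, k, l, hkl, hP⟩ := exists_weakPullback f p
  refine ⟨(toInjStable C).obj P, (toInjStable C).map k, ?_, ?_⟩
  · rw [← Functor.map_comp, toInjStable_map_eq_zero_iff, hkl]
    exact ⟨B, l, p, hB, rfl⟩
  · rintro ⟨W⟩ g hg
    obtain ⟨g, rfl⟩ := (toInjStable C).map_surjective (X := W) (Y := X) g
    rw [← Functor.map_comp, toInjStable_map_eq_zero_iff] at hg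
    obtain ⟨I, a, b, hI, hab⟩ := hg
    obtain ⟨c, rfl⟩ := hp b hI
    obtain ⟨m, hm, -⟩ := hP g (a ≫ c) (by rw [Category.assoc, hab])
    exact ⟨(toInjStable C).map m, by rw [← Functor.map_comp, hm]⟩

end InjStable

/-! ### The abelian category of finitely presented modules -/

section Modules

variable {C : Type u} [Category.{v} C] [Preadditive C]

/-- A morphism from a representable module lifts along an epimorphism from a representable module.
The target need not be an additive functor. -/
lemma exists_map_comp_eq_of_epi {W Y : C} {F : Cᵒᵖ ⥤ AddCommGrpCat.{v}}
    (p : preadditiveYoneda.obj Y ⟶ F) [Epi p] (φ : preadditiveYoneda.obj W ⟶ F) :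
    ∃ g : W ⟶ Y, preadditiveYoneda.map g ≫ p = φ := by
  have hp : Function.Surjective (p.app (.op W)) :=
    (AddCommGrpCat.epi_iff_surjective _).1 inferInstance
  obtain ⟨g, hg⟩ := hp (φ.app (.op W) (𝟙 W : W ⟶ W))
  refine ⟨g, ?_⟩
  ext Z x
  have h1 := ConcreteCategory.congr_hom (p.naturality (Quiver.Hom.op (x : Z.unop ⟶ W))) g
  have h2 := ConcreteCategory.congr_hom (φ.naturality (Quiver.Hom.op (x : Z.unop ⟶ W)))
    (𝟙 W : W ⟶ W)
  have h3 : (preadditiveYoneda.obj W).map (Quiver.Hom.op (x : Z.unop ⟶ W)) (𝟙 W : W ⟶ W) = x :=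
    Category.comp_id (x : Z.unop ⟶ W)
  change p.app (.op Z.unop) ((x : Z.unop ⟶ W) ≫ g) = φ.app (.op Z.unop) x
  refine h1.trans ?_
  refine (congrArg (F.map (Quiver.Hom.op (x : Z.unop ⟶ W))) hg).trans ?_
  refine h2.symm.trans ?_
  exact congrArg _ h3

lemma exists_map_comp_eq_of_exact {W Y : C} {F G : Cᵒᵖ ⥤ AddCommGrpCat.{v}}
    {a : preadditiveYoneda.obj Y ⟶ F} {b : F ⟶ G} (w : a ≫ b = 0)
    (h : (ShortComplex.mk a b w).Exact) (φ : preadditiveYoneda.obj W ⟶ F) (hφ : φ ≫ b = 0) :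
    ∃ g : W ⟶ Y, preadditiveYoneda.map g ≫ a = φ := by
  have : Epi (kernel.lift b a w) := h.epi_kernelLift
  obtain ⟨g, hg⟩ := exists_map_comp_eq_of_epi (kernel.lift b a w) (kernel.lift b φ hφ)
  exact ⟨g, by simpa using congr($hg ≫ kernel.ι b)⟩

/-- Exactness at a representable module may be tested on morphisms of `C`. -/
lemma exact_iff_exists_comp_eq {X Y : C} {F : Cᵒᵖ ⥤ AddCommGrpCat.{v}} (f : X ⟶ Y)
    (p : preadditiveYoneda.obj Y ⟶ F) (w : preadditiveYoneda.map f ≫ p = 0) :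
    (ShortComplex.mk _ p w).Exact ↔ ∀ ⦃W : C⦄ (g : W ⟶ Y), preadditiveYoneda.map g ≫ p = 0 →
      ∃ k : W ⟶ X, k ≫ f = g := by
  constructor
  · intro h W g hg
    obtain ⟨k, hk⟩ := exists_map_comp_eq_of_exact w h _ hg
    exact ⟨k, preadditiveYoneda.map_injective (by simpa using hk)⟩
  · intro h
    refine (ShortComplex.exact_iff_epi_kernel_lift _).2 ?_
    rw [NatTrans.epi_iff_epi_app]
    intro Z
    rw [AddCommGrpCat.epi_iff_surjective]
    intro x
    let y : Z.unop ⟶ Y := (kernel.ι p).app Z x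
    have hy : p.app Z y = 0 :=
      ConcreteCategory.congr_hom (NatTrans.congr_app (kernel.condition p) Z) x
    obtain ⟨k, hk⟩ := h y (by
      ext V t
      have h1 := ConcreteCategory.congr_hom (p.naturality (Quiver.Hom.op (t : V.unop ⟶ Z.unop))) y
      refine h1.trans ?_
      refine (congrArg (F.map (Quiver.Hom.op (t : V.unop ⟶ Z.unop))) hy).trans ?_
      exact map_zero _)
    refine ⟨k, ?_⟩
    have hinj : Function.Injective ((kernel.ι p).app Z) :=
      (AddCommGrpCat.mono_iff_injective _).1 inferInstance
    apply hinj
    refine (ConcreteCategory.congr_hom (NatTrans.congr_app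
      (kernel.lift_ι p (preadditiveYoneda.map f) w) Z) k).trans ?_
    exact hk

instance (C : Type u) [Category.{v} C] [Preadditive C] :
    (preadditiveYoneda : C ⥤ Cᵒᵖ ⥤ AddCommGrpCat.{v}).Additive where
  map_add {X Y f g} := by
    ext Z x
    exact Preadditive.comp_add _ _ _ (x : Z.unop ⟶ X) f g

lemma mono_preadditiveYoneda_map {X Y : C} (f : X ⟶ Y) [Mono f] :
    Mono (preadditiveYoneda.map f) := by
  rw [NatTrans.mono_iff_mono_app]
  intro Z
  rw [AddCommGrpCat.mono_iff_injective]
  intro x y hxy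
  exact (cancel_mono (Z := (Z.unop : C)) f).1 hxy

lemma finitelyPresented_yoneda (X : C) : finitelyPresented C (preadditiveYoneda.obj X) := by
  refine ⟨X, X, 0, 𝟙 _, by simp, ?_, inferInstance⟩
  rw [exact_iff_exists_comp_eq]
  intro W g hg
  refine ⟨0, preadditiveYoneda.map_injective ?_⟩
  simpa using hg.symm

instance : (finitelyPresented C).IsClosedUnderIsomorphisms where
  of_iso := by
    rintro F G e ⟨X, Y, f, p, w, h, hp⟩
    refine ⟨X, Y, f, p ≫ e.hom, by rw [reassoc_of% w, zero_comp], ?_, epi_comp _ _⟩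
    rw [exact_iff_exists_comp_eq] at h ⊢
    intro W g hg
    exact h g (by rwa [← cancel_mono e.hom, Category.assoc, zero_comp])

variable [HasFiniteBiproducts C]

instance : (finitelyPresented C).IsClosedUnderCokernels where
  cokernels_le := by
    have := hasBinaryBiproducts_of_finite_biproducts C
    rintro _ ⟨φ, c, hc, ⟨X, Y, f, p, w, h, hp⟩, ⟨X', Y', f', p', w', h', hp'⟩⟩
    have : Epi c.π := Cofork.IsColimit.epi hc
    obtain ⟨g, hg⟩ := exists_map_comp_eq_of_epi p' (p ≫ φ)
    refine ⟨Y ⊞ X', Y', biprod.desc g f', p' ≫ c.π, ?_, ?_, epi_comp _ _⟩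
    · rw [biprod.desc_eq]
      simp [reassoc_of% hg, reassoc_of% w', CokernelCofork.condition]
    rw [exact_iff_exists_comp_eq] at h' ⊢
    intro W t ht
    have hex : (ShortComplex.mk φ c.π c.condition).Exact :=
      ShortComplex.exact_of_g_is_cokernel _
        (IsColimit.ofIsoColimit hc (Cofork.ext (Iso.refl _) (by simp)))
    have hex' : (ShortComplex.mk (p ≫ φ) c.π (by simp [CokernelCofork.condition])).Exact := by
      rw [ShortComplex.exact_iff_exact_up_to_refinements] at hex ⊢
      intro A x hx
      obtain ⟨A₁, π₁, hπ₁, y, hy⟩ := hex x hx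
      obtain ⟨A₂, π₂, hπ₂, z, hz⟩ := surjective_up_to_refinements_of_epi p y
      refine ⟨A₂, π₂ ≫ π₁, epi_comp _ _, z, ?_⟩
      dsimp at hy ⊢
      rw [Category.assoc, hy, reassoc_of% hz]
    obtain ⟨k, hk⟩ := exists_map_comp_eq_of_exact _ hex' (preadditiveYoneda.map t ≫ p')
      (by simpa using ht)
    obtain ⟨l, hl⟩ := h' (t - k ≫ g) (by
      rw [Functor.map_sub, Preadditive.sub_comp, Functor.map_comp, Category.assoc, hg, hk,
        sub_self])
    exact ⟨biprod.lift k l, by simp [hl]⟩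

instance : (finitelyPresented C).ContainsZero where
  exists_zero := by
    exact ⟨_, preadditiveYoneda.map_isZero (isZero_zero C), finitelyPresented_yoneda _⟩

lemma finitelyPresented_biprod {F G : Cᵒᵖ ⥤ AddCommGrpCat.{v}} (hF : finitelyPresented C F)
    (hG : finitelyPresented C G) : finitelyPresented C (F ⊞ G) := by
  have := hasBinaryBiproducts_of_finite_biproducts C
  obtain ⟨X, Y, f, p, w, h, hp⟩ := hF
  obtain ⟨X', Y', f', p', w', h', hp'⟩ := hG
  rw [exact_iff_exists_comp_eq] at h h'
  refine ⟨X ⊞ X', Y ⊞ Y', biprod.map f f',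
    biprod.lift (preadditiveYoneda.map biprod.fst ≫ p) (preadditiveYoneda.map biprod.snd ≫ p'),
    ?_, ?_, ?_⟩
  · apply biprod.hom_ext <;>
      simp only [Category.assoc, biprod.lift_fst, biprod.lift_snd, zero_comp] <;>
      simp only [← Functor.map_comp_assoc, biprod.map_fst, biprod.map_snd] <;>
      simp only [Functor.map_comp_assoc, w, w', comp_zero]
  · rw [exact_iff_exists_comp_eq]
    intro W g hg
    have h₁ := congr($hg ≫ biprod.fst)
    have h₂ := congr($hg ≫ biprod.snd)
    simp only [Category.assoc, biprod.lift_fst, biprod.lift_snd, zero_comp,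
      ← Functor.map_comp_assoc] at h₁ h₂
    obtain ⟨k, hk⟩ := h _ h₁
    obtain ⟨l, hl⟩ := h' _ h₂
    exact ⟨biprod.lift k l, by ext <;> simp [hk, hl]⟩
  · refine Preadditive.epi_of_cancel_zero _ fun {Q} t ht => ?_
    have h₁ : preadditiveYoneda.map biprod.inl ≫
        biprod.lift (preadditiveYoneda.map (biprod.fst : Y ⊞ Y' ⟶ Y) ≫ p)
          (preadditiveYoneda.map biprod.snd ≫ p') = p ≫ biprod.inl := by
      apply biprod.hom_ext <;> simp only [Category.assoc, biprod.lift_fst, biprod.lift_snd,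
        biprod.inl_fst,
        biprod.inl_snd, ← Functor.map_comp_assoc] <;> simp
    have h₂ : preadditiveYoneda.map biprod.inr ≫
        biprod.lift (preadditiveYoneda.map (biprod.fst : Y ⊞ Y' ⟶ Y) ≫ p)
          (preadditiveYoneda.map biprod.snd ≫ p') = p' ≫ biprod.inr := by
      apply biprod.hom_ext <;> simp only [Category.assoc, biprod.lift_fst, biprod.lift_snd,
        biprod.inr_fst,
        biprod.inr_snd, ← Functor.map_comp_assoc] <;> simp
    apply biprod.hom_ext'
    · rw [← cancel_epi p, ← reassoc_of% h₁, ht]; simp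
    · rw [← cancel_epi p', ← reassoc_of% h₂, ht]; simp

instance : (finitelyPresented C).IsClosedUnderBinaryProducts where
  limitsOfShape_le := by
    rintro F ⟨p⟩
    exact (finitelyPresented C).prop_of_iso
      (IsLimit.conePointsIsoOfNatIso p.isLimit (BinaryBiproduct.isLimit _ _)
        (diagramIsoPair p.diag)).symm
      (finitelyPresented_biprod (p.prop_diag_obj _) (p.prop_diag_obj _))

instance : (finitelyPresented C).IsClosedUnderFiniteProducts :=
  ObjectProperty.IsClosedUnderFiniteProducts.mk'

/-- The kernel of a morphism `F ⟶ G` of finitely presented modules is presented by weak pullbacks: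
one of a lift of the morphism to projective presentations, and one computing the relations. -/
instance [HasWeakKernels C] : (finitelyPresented C).IsClosedUnderKernels where
  kernels_le := by
    have := hasBinaryBiproducts_of_finite_biproducts C
    rintro _ ⟨φ, c, hc, ⟨X, Y, f, p, w, h, hp⟩, ⟨X', Y', f', p', w', h', hp'⟩⟩
    have : Mono c.ι := Fork.IsLimit.mono hc
    rw [exact_iff_exists_comp_eq] at h h'
    obtain ⟨g, hg⟩ := exists_map_comp_eq_of_epi p' (p ≫ φ)
    obtain ⟨Z, z, y, hzy, hZ⟩ := exists_weakPullback g f'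
    obtain ⟨R, r, s, hrs, hR⟩ := exists_weakPullback z f
    have hz : preadditiveYoneda.map z ≫ p ≫ φ = 0 := by
      rw [← hg, ← Functor.map_comp_assoc, hzy, Functor.map_comp_assoc, w', comp_zero]
    have hex : (ShortComplex.mk (preadditiveYoneda.map z) (p ≫ φ) hz).Exact := by
      rw [exact_iff_exists_comp_eq]
      intro W t ht
      obtain ⟨k, hk⟩ := h' (t ≫ g) (by rw [Functor.map_comp_assoc, hg, ht])
      obtain ⟨l, hl, -⟩ := hZ t k hk.symm
      exact ⟨l, hl⟩
    obtain ⟨a, ha⟩ := KernelFork.IsLimit.lift' hc (preadditiveYoneda.map z ≫ p)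
      (by rw [Category.assoc, hz])
    refine ⟨R, Z, r, a, ?_, ?_, ?_⟩
    · rw [← cancel_mono c.ι, Category.assoc, ha, ← Functor.map_comp_assoc, hrs,
        Functor.map_comp_assoc, w, comp_zero, zero_comp]
    · rw [exact_iff_exists_comp_eq]
      intro W t ht
      obtain ⟨k, hk⟩ := h (t ≫ z) (by
        rw [Functor.map_comp_assoc, ← ha, reassoc_of% ht, zero_comp])
      obtain ⟨l, hl, -⟩ := hR t k hk.symm
      exact ⟨l, hl⟩
    · rw [epi_iff_surjective_up_to_refinements]
      intro A x
      obtain ⟨A₁, π₁, hπ₁, x₁, hx₁⟩ := surjective_up_to_refinements_of_epi p (x ≫ c.ι)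
      obtain ⟨A₂, π₂, hπ₂, x₂, hx₂⟩ := hex.exact_up_to_refinements x₁ (by
        rw [← reassoc_of% hx₁, KernelFork.condition, comp_zero, comp_zero])
      refine ⟨A₂, π₂ ≫ π₁, epi_comp _ _, x₂, ?_⟩
      dsimp at hx₂
      rw [← cancel_mono c.ι, Category.assoc, Category.assoc, Category.assoc, ha, hx₁,
        reassoc_of% hx₂]

/-- An epimorphism of finitely presented modules is an epimorphism of functors, since its cokernel
is finitely presented. -/
lemma epi_hom_of_epi {F G : FPMod C} (e : F ⟶ G) [Epi e] : Epi e.hom := by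
  let π : G ⟶ ⟨_, (finitelyPresented C).prop_cokernel e.hom F.property G.property⟩ :=
    ObjectProperty.homMk (cokernel.π e.hom)
  have hπ : π = 0 := by
    rw [← cancel_epi e]
    ext1
    simp [π]
  have hπ' : cokernel.π e.hom = 0 := congr($(hπ).hom)
  exact Preadditive.epi_of_cokernel_zero hπ'

/-- The finitely presented module represented by an object. -/
abbrev fpYoneda (X : C) : FPMod C := ⟨preadditiveYoneda.obj X, finitelyPresented_yoneda X⟩

instance (X : C) : Projective (fpYoneda X) where
  factors {F G} φ e _ := by
    have := epi_hom_of_epi e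
    obtain ⟨_, Z, _, p, _, _, hp⟩ := F.property
    obtain ⟨g, hg⟩ := exists_map_comp_eq_of_epi (p ≫ e.hom) φ.hom
    refine ⟨ObjectProperty.homMk (preadditiveYoneda.map g ≫ p), ?_⟩
    ext1
    simpa using hg

end Modules

/-! ### The global dimension of the category of finitely presented modules -/

/-- In an abelian category of global dimension at most `1`, the image of a morphism to a projective
object is projective, so that the epimorphism onto it splits. -/
lemma exists_split_image {A : Type u} [Category.{v} A] [Abelian A] (hA : GlobalDimensionLE A 1)
    {P Q : A} [Projective Q] (f : P ⟶ Q) :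
    ∃ (I : A) (π : P ⟶ I) (i : I ⟶ Q) (σ : I ⟶ P), σ ≫ π = 𝟙 I ∧ π ≫ i = f ∧ Mono i := by
  have hS : (ShortComplex.mk (image.ι f) (cokernel.π (image.ι f))
      (cokernel.condition _)).ShortExact :=
    { exact := ShortComplex.exact_of_g_is_cokernel _ (cokernelIsCokernel _) }
  have : HasProjectiveDimensionLT (image f) 1 :=
    (hS.hasProjectiveDimensionLT_X₃_iff 0 ‹_›).1 (hA _)
  have : Projective (image f) := projective_iff_hasProjectiveDimensionLT_one.2 this
  exact ⟨image f, factorThruImage f, image.ι f, Projective.factorThru (𝟙 _) (factorThruImage f),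
    by simp, by simp, inferInstance⟩

section GlobalDimension

variable {C : Type u} [Category.{v} C] [Preadditive C] [HasFiniteBiproducts C]

lemma AxiomZeroF1.hasZeroKernels [IsIdempotentComplete C] (h : AxiomZeroF1 C) :
    HasZeroKernels C := by
  intro X Y f
  obtain ⟨I, π, i, σ, hσ, hπ, hi⟩ : ∃ (I : FPMod C) (π : fpYoneda X ⟶ I) (i : I ⟶ fpYoneda Y)
      (σ : I ⟶ fpYoneda X), σ ≫ π = 𝟙 I ∧
        π ≫ i = ObjectProperty.homMk (preadditiveYoneda.map f) ∧ Mono i := by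
    obtain ⟨_, hA⟩ := h
    exact exists_split_image hA _
  -- the idempotent of `X` with image `I`
  obtain ⟨e, he⟩ := preadditiveYoneda.map_surjective (π ≫ σ).hom
  obtain ⟨V, q, p, hqp, hpq⟩ := IsIdempotentComplete.idempotents_split X e
    (preadditiveYoneda.map_injective (by
      rw [Functor.map_comp, he, ← ObjectProperty.FullSubcategory.comp_hom, Category.assoc,
        reassoc_of% hσ]))
  have hef : e ≫ f = f := by
    refine preadditiveYoneda.map_injective ?_
    have : (π ≫ σ) ≫ π ≫ i = π ≫ i := by rw [Category.assoc, reassoc_of% hσ]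
    rw [hπ] at this
    rw [Functor.map_comp, he]
    exact congr($(this).hom)
  refine ⟨V, p, q ≫ f, ⟨⟨q, hqp⟩⟩, ⟨fun {W} a b hab => ?_⟩, by rw [reassoc_of% hpq, hef]⟩
  have hi' : (ObjectProperty.homMk (preadditiveYoneda.map (a ≫ q)) : fpYoneda W ⟶ fpYoneda X) ≫ π =
      (ObjectProperty.homMk (preadditiveYoneda.map (b ≫ q)) : fpYoneda W ⟶ fpYoneda X) ≫ π := by
    rw [← cancel_mono i, Category.assoc, Category.assoc, hπ]
    ext1
    simpa using congr(preadditiveYoneda.map $hab)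
  have hae : a ≫ q ≫ e = b ≫ q ≫ e := by
    refine preadditiveYoneda.map_injective ?_
    have := congr(($hi' ≫ σ).hom)
    simpa [he] using this
  rw [← hpq, reassoc_of% hqp] at hae
  have := congr($hae ≫ p)
  simpa [hqp] using this

/-- A presentation `C(-, X) ⟶ C(-, Y)` of a finitely presented module may be replaced by the
monomorphism part of a factorization of `X ⟶ Y`, so that it becomes a projective resolution of
length `1`. -/
lemma HasZeroKernels.axiomZeroF1 (h : HasZeroKernels C) : AxiomZeroF1 C := by
  have := h.hasWeakKernels
  refine ⟨inferInstance, fun F => ?_⟩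
  obtain ⟨X, Y, f, p, w, hex, hp⟩ := F.property
  obtain ⟨V, s, r, ⟨⟨t⟩⟩, hr, rfl⟩ := h f
  have ht := t.id
  have w' : preadditiveYoneda.map r ≫ p = 0 := by
    have := congr(preadditiveYoneda.map t.section_ ≫ $w)
    rwa [comp_zero, ← Functor.map_comp_assoc, reassoc_of% ht] at this
  let S : ShortComplex (FPMod C) := ShortComplex.mk (X₁ := fpYoneda V) (X₂ := fpYoneda Y)
    (X₃ := F) (ObjectProperty.homMk (preadditiveYoneda.map r)) (ObjectProperty.homMk p)
    (by ext1; exact w')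
  have := mono_preadditiveYoneda_map r
  have hf : Mono S.f := (finitelyPresented C).ι.mono_of_mono_map (f := S.f) this
  have hg : Epi S.g := (finitelyPresented C).ι.epi_of_epi_map (f := S.g) hp
  have hι : (finitelyPresented C).ι.PreservesHomology :=
    { preservesKernels := fun _ _ f => (finitelyPresented C).preservesKernels_ι f
      preservesCokernels := fun _ _ f => (finitelyPresented C).preservesCokernels_ι f }
  have hS : S.Exact := by
    rw [← S.exact_map_iff_of_faithful (finitelyPresented C).ι]
    refine (exact_iff_exists_comp_eq r p w').2 fun W g hg => ?_
    obtain ⟨k, hk⟩ := (exact_iff_exists_comp_eq _ p w).1 hex g hg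
    exact ⟨k ≫ s, by simpa using hk⟩
  have hS' : S.ShortExact := { exact := hS }
  exact (hS'.hasProjectiveDimensionLT_X₃_iff 0 (inferInstanceAs (Projective (fpYoneda Y)))).2
    (inferInstanceAs (HasProjectiveDimensionLT (fpYoneda V) 1))

end GlobalDimension

/-- An additive category is `0`-abelian exactly when every morphism is a split epimorphism followed
by a monomorphism and every morphism is an epimorphism followed by a split monomorphism. -/
lemma isZeroAbelian_iff {C : Type u} [Category.{v} C] [Preadditive C] [HasFiniteBiproducts C] :
    IsZeroAbelian C ↔ HasZeroKernels C ∧ HasZeroCokernels C := by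
  have : HasFiniteBiproducts Cᵒᵖ := HasFiniteBiproducts.of_hasFiniteProducts
  constructor
  · intro h
    have := h.idempotentComplete
    exact ⟨h.f1.hasZeroKernels, hasZeroKernels_op_iff.1 h.f1_op.hasZeroKernels⟩
  · rintro ⟨h₁, h₂⟩
    exact ⟨inferInstance, h₂.isIdempotentComplete, h₁.axiomZeroF1,
      (hasZeroKernels_op_iff.2 h₂).axiomZeroF1⟩

end NAbelian

theorem corollary4 {C : Type u} [Category.{v} C] [Preadditive C] [HasFiniteBiproducts C]
    [EnoughInjectives C] (hC : IsZeroAbelian C) :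
    (HasFiniteBiproducts (InjStable C) ∧ IsIdempotentComplete (InjStable C) ∧
      HasZeroCokernels (InjStable C)) ∧
    [IsZeroAbelian (InjStable C),
      ∃ n : ℕ, IsNAbelian (InjStable C) n,
      HasWeakKernels (InjStable C)].TFAE ∧
    (IsContravariantlyFinite (isInjective C) → IsZeroAbelian (InjStable C)) := by
  obtain ⟨hk, hc⟩ := isZeroAbelian_iff.1 hC
  have hs : HasZeroCokernels (InjStable C) := hc.injStable
  have key : HasWeakKernels (InjStable C) → IsZeroAbelian (InjStable C) := fun _ =>
    isZeroAbelian_iff.2 ⟨hs.hasZeroKernels, hs⟩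
  refine ⟨⟨inferInstance, hs.isIdempotentComplete, hs⟩, ?_, fun h => ?_⟩
  · tfae_have 1 → 2 := fun h => ⟨0, h⟩
    tfae_have 2 → 3
      | ⟨0, h⟩ => (isZeroAbelian_iff.1 h).1.hasWeakKernels
      | ⟨_ + 1, h⟩ => h.hasWeakKernels
    tfae_have 3 → 1 := key
    tfae_finish
  · have := hk.hasWeakKernels
    exact key (hasWeakKernels_injStable h)
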